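/- Let $X$ be a finite set and let $\mathcal F$ be a nonempty family of subsets of $X$; we call $(X,\mathcal F)$ a set system. \emph{Definitions.} The one-inclusion graph $G_{\mathcal F}$ is the simple edge-labelled directed graph whose vertices are the members of $\mathcal F$, with an edge from $A$ to $B$ labelled $b$ whenever $b\in X\setminus A$ and $B=A\cup\{b\}$. For a directed graph, connectedness, the distance $d$, degrees and being a tree refer to the underlying undirected graph. A family $\mathcal F$ is \emph{well-graded} if $d_{G_{\mathcal F}}(A,B)=|A\triangle B|$ for all $A,B\in\mathcal F$, where the distance is $\infty$ between different connected components; the empty family of subsets counts as well-graded. The \emph{essential domain} $\mathrm{ess}_{\mathcal F}(X)$ is the set of all $x\in X$ for which there are $A,B\in\mathcal F$ with $x\in A$ and $x\notin B$. The \emph{additionality} of $(X,\mathcal F)$ is $|\mathcal F|-|\mathrm{ess}_{\mathcal F}(X)|$. The \emph{dual} of $(X,\mathcal F)$ is the family $\mathcal F^*=\{\mathcal A_x: x\in X\}$ of subsets of $\mathcal F$, where $\mathcal A_x=\{A\in\mathcal F: x\in A\}$ (a set, without multiplicities); the \emph{essential dual} is its subfamily $\mathcal F^*_{ess}=\{\mathcal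 A_x: x\in \mathrm{ess}_{\mathcal F}(X)\}$, again as a family of subsets of $\mathcal F$. The system is \emph{self-and-dual well-graded} if $\mathcal F$ and $\mathcal F^*$ are well-graded, and \emph{self-and-ess-dual well-graded} if $\mathcal F$ and $\mathcal F^*_{ess}$ are well-graded. The system is a \emph{full-chain system} if the members of $\mathcal F$ can be listed as $A_1\subseteq A_2\subseteq\dots\subseteq A_n$ with $|A_i\setminus A_{i-1}|=1$ for $2\le i\le n$. A vertex $v$ of a connected directed graph is a \emph{source} (respectively a \emph{sink}) if every edge, directed from $w$ to $z$, satisfies $d(w,v)<d(z,v)$ (respectively $d(w,v)>d(z,v)$). An edge-labelled directed tree is \emph{starlike} with centre $v_0$ if different edges have different labels, $v_0$ has degree at least $2$ and is a source or a sink, and all other vertices have degree at most $2$. The system is \emph{upward-starlike} if $\emptyset\in\mathcal F$, $G_{\mathcal F}$ is a starlike tree whose centre is the vertex $\emptyset$ and this centre is a source, and some element of $X$ belongs to no member of $\mathcal F$. It is \emph{downward-starlike} if $X\in\mathcal F$, $G_{\mathcal F}$ is a starlike tree whose centre is the vertex $X$ and this centre is a sink, and some element of $X$ belongs to every member of $\mathcal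 F$. \textbf{Theorem.} Let $(X,\mathcal F)$ be a set system with $X$ finite and $\mathcal F$ nonempty. \begin{enumerate} \item $(X,\mathcal F)$ is self-and-dual well-graded if and only if it is a full-chain system, an upward-starlike system or a downward-starlike system. Moreover, every self-and-dual well-graded system has additionality $1$. \item $(X,\mathcal F)$ is self-and-ess-dual well-graded if and only if it is a full-chain system. Moreover, every self-and-ess-dual well-graded system has additionality $1$. \end{enumerate} -/

import Mathlib

/-- A simple edge-labelled directed graph: `Edge v w l` says that there is an edge directed from
`v` to `w` and that its label is `l`. -/
structure LabelledDigraph (V L : Type*) where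
  Edge : V → V → L → Prop
  label_unique : ∀ v w l l', Edge v w l → Edge v w l' → l = l'
  asymm : ∀ v w l l', Edge v w l → ¬ Edge w v l'

namespace LabelledDigraph

variable {V L : Type*}

/-- The underlying undirected graph; connectedness, distances, degrees and being a tree are
understood in this graph. -/
def underlying (G : LabelledDigraph V L) : SimpleGraph V where
  Adj v w := (∃ l, G.Edge v w l) ∨ (∃ l, G.Edge w v l)
  symm := ⟨fun _ _ h => h.symm⟩
  loopless := ⟨fun v h => by
    rcases h with ⟨l, h⟩ | ⟨l, h⟩ <;> exact G.asymm v v l l h h⟩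

/-- The degree of a vertex in the underlying undirected graph. -/
noncomputable def degree (G : LabelledDigraph V L) (v : V) : ℕ∞ :=
  (G.underlying.neighborSet v).encard

/-- Different edges carry different labels. -/
def LabelsDistinct (G : LabelledDigraph V L) : Prop :=
  ∀ v w v' w' l, G.Edge v w l → G.Edge v' w' l → v = v' ∧ w = w'

/-- `v` is a source of a connected directed graph: every edge is getting far from `v`. -/
def IsSource (G : LabelledDigraph V L) (v : V) : Prop :=
  G.underlying.Connected ∧
    ∀ w z l, G.Edge w z l → G.underlying.dist w v < G.underlying.dist z v

/-- `v` is a sink of a connected directed graph: every edge is getting closer to `v`. -/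
def IsSink (G : LabelledDigraph V L) (v : V) : Prop :=
  G.underlying.Connected ∧
    ∀ w z l, G.Edge w z l → G.underlying.dist z v < G.underlying.dist w v

/-- `G` is a starlike tree with centre `c`. -/
def IsStarlike (G : LabelledDigraph V L) (c : V) : Prop :=
  G.underlying.IsTree ∧ G.LabelsDistinct ∧ 2 ≤ G.degree c ∧ (G.IsSource c ∨ G.IsSink c) ∧
    ∀ v, v ≠ c → G.degree v ≤ 2

end LabelledDigraph

namespace SetSystem

variable {X : Type*} [DecidableEq X]

/-- The one-inclusion graph of a family `F` of subsets of `X`: its vertices are the members of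
`F`, and there is an edge from `A` to `B` with label `b` when `B` is the union of `A` and `{b}`,
with `b` outside `A` (there are no loops). -/
def oneInclusionGraph (F : Finset (Finset X)) : LabelledDigraph F X where
  Edge A B b := b ∉ A.1 ∧ B.1 = insert b A.1
  label_unique := by
    rintro A B b b' ⟨hb, h⟩ ⟨hb', h'⟩
    have h1 : b ∈ insert b' A.1 := by rw [← h', h]; exact Finset.mem_insert_self b A.1
    rcases Finset.mem_insert.1 h1 with h2 | h2
    · exact h2
    · exact absurd h2 hb
  asymm := by
    rintro A B b b' ⟨hb, h⟩ ⟨hb', h'⟩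
    apply hb
    rw [h', h]
    exact Finset.mem_insert_of_mem (Finset.mem_insert_self b A.1)

/-- Well-graded families: the Hamming distance of any two members is their distance in the
one-inclusion graph. The distance `edist` is infinite between different connected components. The
empty family, which can occur as a dual, is well-graded. -/
def IsWellGraded (F : Finset (Finset X)) : Prop :=
  ∀ A B : F, (oneInclusionGraph F).underlying.edist A B = ((symmDiff A.1 B.1).card : ℕ∞)

/-- The essential domain: the elements that belong to some but not to all members of `F`. -/
def ess [Fintype X] (F : Finset (Finset X)) : Finset X :=
  Finset.univ.filter fun x => (∃ A ∈ F, x ∈ A) ∧ ∃ B ∈ F, x ∉ B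

/-- The additionality of a system. -/
def additionality [Fintype X] (F : Finset (Finset X)) : ℤ :=
  (F.card : ℤ) - ((ess F).card : ℤ)

/-- The set of all members of `F` that contain `x`, as a subset of the domain `F` of the dual. -/
def dualSet (F : Finset (Finset X)) (x : X) : Finset F :=
  Finset.univ.filter fun A => x ∈ A.1

/-- The dual system, a family of subsets of `F`. -/
def dual [Fintype X] (F : Finset (Finset X)) : Finset (Finset F) :=
  Finset.univ.image (dualSet F)

/-- The essential dual system, a family of subsets of `F`. -/
def essDual [Fintype X] (F : Finset (Finset X)) : Finset (Finset F) :=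
  (ess F).image (dualSet F)

/-- Self-and-dual well-graded systems. -/
def IsSelfAndDualWellGraded [Fintype X] (F : Finset (Finset X)) : Prop :=
  IsWellGraded F ∧ IsWellGraded (dual F)

/-- Self-and-ess-dual well-graded systems. -/
def IsSelfAndEssDualWellGraded [Fintype X] (F : Finset (Finset X)) : Prop :=
  IsWellGraded F ∧ IsWellGraded (essDual F)

/-- The members of `F` can be listed as a full-chain, in which every set after the first one
is obtained from the set before it by adding exactly one element. -/
def IsFullChainSystem (F : Finset (Finset X)) : Prop :=
  ∃ l : List (Finset X), l.Nodup ∧ l.toFinset = F ∧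
    l.IsChain fun A B => A ⊆ B ∧ (B \ A).card = 1

/-- Upward-starlike systems. -/
def IsUpwardStarlike (F : Finset (Finset X)) : Prop :=
  (∃ h : ∅ ∈ F, (oneInclusionGraph F).IsStarlike ⟨∅, h⟩ ∧
      (oneInclusionGraph F).IsSource ⟨∅, h⟩) ∧
    ∃ x : X, ∀ A ∈ F, x ∉ A

/-- Downward-starlike systems. -/
def IsDownwardStarlike [Fintype X] (F : Finset (Finset X)) : Prop :=
  (∃ h : Finset.univ ∈ F, (oneInclusionGraph F).IsStarlike ⟨Finset.univ, h⟩ ∧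
      (oneInclusionGraph F).IsSink ⟨Finset.univ, h⟩) ∧
    ∃ x : X, ∀ A ∈ F, x ∈ A

end SetSystem

/-! View a family as the incidence relation between its members (rows) and the elements of the
domain (columns). Passing to the dual transposes the relation, and negating it exchanges upward and
downward. Well-gradedness becomes local: from each row one can move towards any different row by
changing a single element (`isWellGraded_iff`, `Steps`).

The engine is a count. Deleting an essential element x from a well-graded family identifies only the
pairs joined by an edge labelled x, and there is at least one such edge. Hence a nonempty
well-graded family has more members than essential elements (`IsStepping.card_ess_lt`), and when the
excess is exactly 1 every label occurs on only one edge (`IsStepping.hasDistinctLabels`). A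
nontrivial member of the family is an essential element of the dual, and conversely an essential
element gives a nontrivial dual set. So the bounds for the family and its dual face each other, with
slack only from ∅, X, an element in no member and an element in every member. At most two of these
four exist, which forces equality throughout and leaves four cases.

Distinct labels then give the shape. Rows below a common row form a chain when there is a least row
(`total_below`). This settles the cases with both extremes on one side, and the essential dual,
where the same count always produces a least and a greatest member. In the mixed cases, using the
dual as well, branching can occur only at ∅ or at X (`Steps.covers_up_unique`), giving a star or a
chain.

Conversely, in a chain or a star the rows containing x are those at or above the top end of an
x-edge. Adding or removing one row in such a column means passing to a neighbouring edge
(`exists_step_flip_of_total`, `steps_flip_of_star`). -/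

namespace SetSystem

/-! ### Stepping and covering in a binary relation -/

section Relation

variable {ι κ : Type*}

/-- Row `j` of the relation `R` arises from row `i` by adding the single new element `k`. -/
def Covers (R : ι → κ → Prop) (i j : ι) (k : κ) : Prop :=
  ¬ R i k ∧ R j k ∧ ∀ l, l ≠ k → (R i l ↔ R j l)

/-- From each row one can move towards any different row by changing one element. -/
def Steps (R : ι → κ → Prop) : Prop :=
  ∀ i j, (∃ k, ¬ (R i k ↔ R j k)) →
    ∃ k, ¬ (R i k ↔ R j k) ∧ ∃ i', Covers R i i' k ∨ Covers R i' i k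

/-- Each element labels at most one covering pair of rows. -/
def DistinctLabels (R : ι → κ → Prop) : Prop :=
  ∀ i j i' j' k, Covers R i j k → Covers R i' j' k → R i = R i'

variable {R : ι → κ → Prop}

theorem Covers.le {i j : ι} {k : κ} (h : Covers R i j k) : R i ≤ R j := fun l hl => by
  by_cases e : l = k
  · subst e; exact h.2.1
  · exact (h.2.2 l e).1 hl

theorem covers_not {i j : ι} {k : κ} :
    Covers (fun i k => ¬ R i k) i j k ↔ Covers R j i k := by
  unfold Covers; grind

theorem covers_flip_not {i j : κ} {k : ι} :
    Covers (flip fun i k => ¬ R i k) i j k ↔ Covers (flip R) j i k :=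
  covers_not (R := flip R)

theorem injective_not (hR : Function.Injective R) :
    Function.Injective fun i k => ¬ R i k :=
  fun _ _ h => hR (funext fun k => propext (not_iff_not.1 (iff_of_eq (congrFun h k))))

theorem Steps.not (h : Steps R) : Steps fun i k => ¬ R i k := by
  intro i j hij
  obtain ⟨k, hk, i', hi'⟩ := h i j (by simpa [not_iff_not] using hij)
  exact ⟨k, by simpa [not_iff_not] using hk, i', by simpa only [covers_not] using hi'.symm⟩

theorem Steps.of_not (h : Steps fun i k => ¬ R i k) : Steps R := by
  simpa using h.not

theorem Covers.right_eq {i j i' j' : ι} {k : κ} (h : Covers R i j k) (h' : Covers R i' j' k)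
    (e : R i = R i') : R j = R j' := by
  funext l
  by_cases hl : l = k
  · subst hl; exact propext ⟨fun _ => h'.2.1, fun _ => h.2.1⟩
  · rw [← propext (h.2.2 l hl), ← propext (h'.2.2 l hl), e]

theorem DistinctLabels.not (h : DistinctLabels R) : DistinctLabels fun i k => ¬ R i k := by
  intro i j i' j' k h1 h2
  rw [covers_not] at h1 h2
  have := h1.right_eq h2 (h _ _ _ _ _ h1 h2)
  simp [this]

/-- On the way from row `i` to row `j`, an element outside `i` and inside `j` labels some edge. -/
theorem Steps.exists_covers [Finite κ] (h : Steps R) {j : ι} {k : κ} (hj : R j k) (i : ι)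
    (hi : ¬ R i k) : ∃ e e', Covers R e e' k ∧ (∀ l, R i l → R j l → R e l) ∧
      ∀ l, R e l → R i l ∨ R j l := by
  induction hn : {l | ¬ (R i l ↔ R j l)}.ncard using Nat.strong_induction_on generalizing i with
  | _ n ih =>
    obtain ⟨k', hk', i', hi'⟩ := h i j ⟨k, by tauto⟩
    -- A step that changes `k` is the edge sought. Any other step leaves fewer differences from `j`,
    -- and `i'` departs from `i` only at `k'`, where it agrees with `j`, so the bounds carry over
    -- from `i'` to `i`.
    by_cases e : k' = k
    · subst e
      refine ⟨i, i', ?_, fun l h _ => h, fun l h => Or.inl h⟩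
      rcases hi' with h1 | h1
      · exact h1
      · exact absurd h1.2.1 hi
    have hsame : ∀ l, l ≠ k' → (R i' l ↔ R i l) := by
      rcases hi' with h1 | h1
      · exact fun l hl => (h1.2.2 l hl).symm
      · exact h1.2.2
    have hnew : R i' k' ↔ R j k' := by
      rcases hi' with h1 | h1 <;> have := h1.1 <;> have := h1.2.1 <;> tauto
    obtain ⟨a, a', h1, h2, h3⟩ := ih _ (by
      rw [← hn]
      refine Set.ncard_lt_ncard ⟨fun l hl => ?_, fun hs => (hs hk') hnew⟩ (Set.toFinite _)
      by_cases e' : l = k'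
      · subst e'; exact absurd hnew hl
      · simpa [hsame l e'] using hl) i' (by rwa [hsame k (Ne.symm e)]) rfl
    refine ⟨a, a', h1, fun l hl hl' => h2 l ?_ hl', fun l hl => ?_⟩
    · by_cases e' : l = k'
      · subst e'; exact hnew.2 hl'
      · exact (hsame l e').2 hl
    · by_cases e' : l = k'
      · subst e'; rcases h3 l hl with h4 | h4
        · exact Or.inr (hnew.1 h4)
        · exact Or.inr h4
      · rw [← hsame l e']; exact h3 l hl

/-- The rows below a given row form a chain. -/
theorem total_below [Finite κ] (h : Steps R) (hD : DistinctLabels R) {m c i j : ι}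
    (hm : ∀ i, R m ≤ R i) (hi : R i ≤ R c) (hj : R j ≤ R c) : R i ≤ R j ∨ R j ≤ R i := by
  by_contra! hc
  obtain ⟨_, h2⟩ := hc
  obtain ⟨b, hb, hb'⟩ : ∃ b, R j b ∧ ¬ R i b := by
    simpa [Pi.le_def] using h2
  -- The way from `i` up to `c` has a `b`-edge starting above `i`; the way from `m` up to `j` has
  -- one starting below `j`. They are the same edge, so `i` lies below `j`.
  obtain ⟨e, e', he, h3, -⟩ := h.exists_covers (hj b hb) i hb'
  obtain ⟨f, f', hf, -, h4⟩ := h.exists_covers hb m fun hx => hb' (hm i b hx)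
  have hef := hD _ _ _ _ _ he hf
  refine absurd (fun l hl => ?_) ‹¬ R i ≤ R j›
  have := h3 l hl (hi l hl)
  rw [hef] at this
  exact (h4 l this).elim (fun x => hm j l x) id

/-- The way from the empty row to `j'` uses a `k`-edge starting inside `j'`. By distinctness it
starts at `j`, which contains `k'`, whereas `j'` does not. -/
theorem Steps.covers_down_unique [Finite κ] (h : Steps R) (hD : DistinctLabels R) {m i j j' : ι}
    (hm : ∀ k, ¬ R m k) {k k' : κ} (h1 : Covers R j i k) (h2 : Covers R j' i k') : k = k' := by
  by_contra hne
  have hk : R j' k := (h2.2.2 k hne).2 h1.2.1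
  obtain ⟨e, e', he, -, h3⟩ := h.exists_covers hk m (hm k)
  have := hD _ _ _ _ _ he h1
  have h4 : R j k' := (h1.2.2 k' (Ne.symm hne)).2 h2.2.1
  rw [← this] at h4
  exact (h3 _ h4).elim (hm _) h2.1

/-- Any row containing `k` lies above the only `k`-edge, which starts at `i`, so it contains `a`;
likewise for `k'`. The columns `k` and `k'` thus lie below column `a` and are comparable by
`total_below` in the transposed relation, but `j` and `j'` separate them. -/
theorem Steps.covers_up_unique [Finite κ] [Finite ι] (h : Steps R) (hD : DistinctLabels R)
    (h' : Steps (flip R)) (hD' : DistinctLabels (flip R)) {m : ι} (hm : ∀ k, ¬ R m k)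
    {z : κ} (hz : ∀ i, ¬ R i z) {i j j' : ι} {a k k' : κ} (ha : R i a)
    (h1 : Covers R i j k) (h2 : Covers R i j' k') : k = k' := by
  by_contra hne
  have below : ∀ {j k}, Covers R i j k → flip R k ≤ flip R a := by
    intro j k hk b hb
    obtain ⟨e, e', he, -, h3⟩ := h.exists_covers (j := b) hb m (hm k)
    rw [← hD _ _ _ _ _ he hk] at ha
    exact (h3 _ ha).elim (fun x => absurd x (hm a)) id
  rcases total_below h' hD' (m := z) (fun x b hb => absurd hb (hz b)) (below h1) (below h2)
    with h3 | h3
  · exact h2.1 ((h1.2.2 _ (Ne.symm hne)).2 (h3 j h1.2.1))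
  · exact h1.1 ((h2.2.2 _ hne).2 (h3 j' h2.2.1))

/-- Row `j` arises from row `i` by adding one element. -/
def Up (R : ι → κ → Prop) (i j : ι) : Prop := ∃ k, Covers R i j k

theorem le_of_reflTransGen_up {i j : ι} (h : Relation.ReflTransGen (Up R) i j) : R i ≤ R j := by
  induction h with
  | refl => exact le_rfl
  | tail _ h ih => exact ih.trans h.choose_spec.le

theorem ncard_lt_of_covers [Finite κ] {i j : ι} {k : κ} (h : Covers R i j k) :
    {l | R i l}.ncard < {l | R j l}.ncard :=
  Set.ncard_lt_ncard ⟨fun l hl => h.le l hl, fun hs => h.1 (hs h.2.1)⟩ (Set.toFinite _)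

theorem reflTransGen_up_of_parents [Finite κ] {m : ι} (hP : ∀ i, i ≠ m → ∃ j, Up R j i) (i : ι) :
    Relation.ReflTransGen (Up R) m i := by
  induction hn : {l | R i l}.ncard using Nat.strong_induction_on generalizing i with
  | _ n ih =>
    by_cases e : i = m
    · rw [e]
    obtain ⟨j, k, hj⟩ := hP i e
    exact (ih _ (hn ▸ ncard_lt_of_covers hj) j rfl).tail ⟨k, hj⟩

theorem exists_covers_of_parents [Finite κ] {m : ι} (hm : ∀ k, ¬ R m k)
    (hP : ∀ i, i ≠ m → ∃ j, Up R j i) {x : κ} (i : ι) (hx : R i x) :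
    ∃ p t, Covers R p t x ∧ Relation.ReflTransGen (Up R) t i := by
  induction hn : {l | R i l}.ncard using Nat.strong_induction_on generalizing i with
  | _ n ih =>
    obtain ⟨j, k, hj⟩ := hP i (fun e => hm x (e ▸ hx))
    by_cases e : x = k
    · subst e; exact ⟨j, i, hj, .refl⟩
    · obtain ⟨p, t, h1, h2⟩ := ih _ (hn ▸ ncard_lt_of_covers hj) j ((hj.2.2 x e).2 hx) rfl
      exact ⟨p, t, h1, h2.tail ⟨k, hj⟩⟩

theorem Steps.exists_parent (h : Steps R) (hR : Function.Injective R) {m : ι}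
    (hm : ∀ k, ¬ R m k) (i : ι) (hi : i ≠ m) : ∃ j, Up R j i := by
  obtain ⟨k, hk, j, hj⟩ := h i m (by
    by_contra! hc
    exact hi (hR (funext fun k => propext (hc k))))
  rcases hj with hj | hj
  · exact absurd (iff_of_false hj.1 (hm k)) hk
  · exact ⟨j, k, hj⟩

theorem total_of_up_unique [Finite κ] {m : ι} (hP : ∀ i, i ≠ m → ∃ j, Up R j i)
    (hU : ∀ i j j', Up R i j → Up R i j' → j = j') (i j : ι) : R i ≤ R j ∨ R j ≤ R i :=
  (Relation.ReflTransGen.total_of_right_unique (fun a b c h1 h2 => hU a b c h1 h2)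
    (reflTransGen_up_of_parents hP i) (reflTransGen_up_of_parents hP j)).imp
    le_of_reflTransGen_up le_of_reflTransGen_up

/-! ### Stars and their transposes -/

section Star

variable [Finite κ] (hR : Function.Injective R) {m : ι} (hm : ∀ k, ¬ R m k)
  (hP : ∀ i, i ≠ m → ∃ j, Up R j i) (hD : DistinctLabels R)
  (hU : ∀ i, i ≠ m → ∀ j j', Up R i j → Up R i j' → j = j')

include hR hm hP hD in
-- Descending from `i` through parents must at some point remove `x`, and there is only one edge at
-- which this can happen. Column `x` is therefore the set of rows reachable from `t`.
theorem reflTransGen_up_of_covers {p t i : ι} {x : κ} (h : Covers R p t x) (hi : R i x) :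
    Relation.ReflTransGen (Up R) t i := by
  obtain ⟨p', t', h1, h2⟩ := exists_covers_of_parents hm hP i hi
  have := hR (h1.right_eq h (hD _ _ _ _ _ h1 h))
  rwa [← this]

include hR hm hP hD hU in
-- Rows sharing an element `x` lie above the one `x`-edge, where successors are unique, so one is
-- reachable from the other. Rows sharing nothing lie on different arms, and stepping down from `i`
-- approaches `j`.
theorem steps_of_star : Steps R := by
  intro i j hij
  have hne : i ≠ j := by rintro rfl; simp at hij
  have up : Relation.ReflTransGen (Up R) i j →
      ∃ k, ¬ (R i k ↔ R j k) ∧ ∃ i', Covers R i i' k ∨ Covers R i' i k := by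
    intro h
    rcases h.cases_head with h | ⟨i', ⟨k, hk⟩, h⟩
    · exact absurd h hne
    · exact ⟨k, fun e => hk.1 (e.2 (le_of_reflTransGen_up h k hk.2.1)), i', .inl hk⟩
  by_cases hi : i = m
  · exact up (hi ▸ reflTransGen_up_of_parents hP j)
  by_cases hc : ∃ x, R i x ∧ R j x
  · obtain ⟨x, hx, hx'⟩ := hc
    obtain ⟨p, t, h1, h2⟩ := exists_covers_of_parents hm hP i hx
    have h3 := reflTransGen_up_of_covers hR hm hP hD h1 hx'
    have htot : Relation.ReflTransGen (Up R) i j ∨ Relation.ReflTransGen (Up R) j i := by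
      clear hne hij up
      induction h2 with
      | refl => exact .inl h3
      | @tail b c hb hbc ih =>
        by_cases hbm : R b x
        · rcases ih (fun e => hm x (e ▸ hbm)) hbm with h | h
          · rcases h.cases_head with h | ⟨c', hc', h⟩
            · subst h; exact .inr (.single hbc)
            · rw [hU b (fun e => hm x (e ▸ hbm)) c c' hbc hc']; exact .inl h
          · exact .inr (h.tail hbc)
        · exact absurd (le_of_reflTransGen_up hb x h1.2.1) hbm
    rcases htot with h | h
    · exact up h
    · rcases h.cases_tail with h | ⟨i', h, k, hk⟩
      · exact absurd h hne
      · exact ⟨k, fun e => hk.1 (le_of_reflTransGen_up h k (e.1 hk.2.1)), i', .inr hk⟩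
  · obtain ⟨p, k, hk⟩ := hP i hi
    exact ⟨k, fun e => hc ⟨k, hk.2.1, e.1 hk.2.1⟩, p, .inr hk⟩

include hR hm hP hD hU in
theorem steps_flip_of_star [Finite ι] {z : κ} (hz : ∀ i, ¬ R i z) : Steps (flip R) := by
  intro x y hxy
  have reach : ∀ {p t i x}, Covers R p t x → R i x → Relation.ReflTransGen (Up R) t i :=
    reflTransGen_up_of_covers hR hm hP hD
  have ne_m : ∀ {i x}, R i x → i ≠ m := fun h e => hm _ (e ▸ h)
  have step : ∀ {t t' i x}, R t x → Up R t t' → Relation.ReflTransGen (Up R) t i → i ≠ t →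
      Relation.ReflTransGen (Up R) t' i := by
    intro t t' i x hx ht h hi
    rcases h.cases_head with h | ⟨c, hc, h⟩
    · exact absurd h.symm hi
    · rwa [hU t (ne_m hx) t' c ht hc]
  by_cases hx : ∃ i, R i x
  · obtain ⟨i, hi⟩ := hx
    obtain ⟨p, t, h1, -⟩ := exists_covers_of_parents hm hP i hi
    by_cases hy : R t y
    -- Column `x` grows by `p`: the edge into `p` has a label `w` whose column is `p` together with
    -- the rows from `t` on, because `t` is the only successor of the nonempty row `p`.
    · have hxy' : y ≠ x := by rintro rfl; simp at hxy
      have hpy : R p y := (h1.2.2 y hxy').2 hy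
      obtain ⟨q, w, hw⟩ := hP p (ne_m hpy)
      refine ⟨p, fun e => h1.1 (e.2 hpy), w, .inl ⟨h1.1, hw.2.1, fun i hi => ⟨fun h => ?_, fun h => ?_⟩⟩⟩
      · exact le_of_reflTransGen_up (reach h1 h) w (h1.le w hw.2.1)
      · exact le_of_reflTransGen_up (step hpy ⟨x, h1⟩ (reach hw h) hi) x h1.2.1
    · refine ⟨t, fun e => hy (e.1 h1.2.1), ?_⟩
      -- Column `x` loses `t`: the result is the column of the next label on the arm, or the empty
      -- column `z` if `t` is the end of its arm.
      by_cases ht : ∃ t', Up R t t'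
      · obtain ⟨t', k, hk⟩ := ht
        refine ⟨k, .inr ⟨hk.1, h1.2.1, fun i hi => ⟨fun h => ?_, fun h => ?_⟩⟩⟩
        · exact le_of_reflTransGen_up (reach hk h) x (hk.le x h1.2.1)
        · exact le_of_reflTransGen_up (step h1.2.1 ⟨k, hk⟩ (reach h1 h) hi) k hk.2.1
      · refine ⟨z, .inr ⟨hz t, h1.2.1, fun i hi => ⟨fun h => absurd h (hz i), fun h => ?_⟩⟩⟩
        rcases (reach h1 h).cases_head with h | ⟨c, hc, -⟩
        · exact absurd h.symm hi
        · exact absurd ⟨c, hc⟩ ht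
  · obtain ⟨i₀, hi₀⟩ : ∃ i, R i y := by
      by_contra hc
      obtain ⟨i, hi⟩ := hxy
      exact hi (iff_of_false (fun h => hx ⟨i, h⟩) fun h => hc ⟨i, h⟩)
    -- Column `x` is empty. The end `i` of the arm through `y` is entered by an edge whose label has
    -- the singleton column of `i`.
    obtain ⟨i, hi, hmax⟩ := (Set.toFinite {i | R i y}).exists_maximalFor R _ ⟨i₀, hi₀⟩
    have hix : ¬ R i x := fun h => hx ⟨i, h⟩
    obtain ⟨p, w, hw⟩ := hP i (ne_m hi)
    refine ⟨i, fun e => hix (e.2 hi), w, .inl ⟨hix, hw.2.1, fun j hj =>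
      ⟨fun h => absurd ⟨j, h⟩ hx, fun h => ?_⟩⟩⟩
    have hij := le_of_reflTransGen_up (reach hw h)
    exact absurd (hR (le_antisymm (hmax (hij y hi) hij) hij)) hj

end Star

/-- Let `a` be the largest row avoiding `x`, so that column `x` consists of the rows strictly above
`a`. Adding `a` gives the column of the label on the edge into `a`; if `a` is the least row it gives
the full column, which is column `y`. The alternative recorded for `z` keeps the step inside the
essential dual whenever `y` is essential. -/
theorem exists_covers_flip_of_total [Finite ι] (hR : Function.Injective R)
    (ht : ∀ i j, R i ≤ R j ∨ R j ≤ R i) (h : Steps R) {x y : κ} (hxy : ∃ i, ¬ R i x ∧ R i y) :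
    ∃ i, ¬ R i x ∧ R i y ∧ ∃ z, (z = y ∨ (∃ i, R i z) ∧ ∃ i, ¬ R i z) ∧
      Covers (flip R) x z i := by
  obtain ⟨b, hb, hb'⟩ := hxy
  obtain ⟨a, ha, hmax⟩ := (Set.toFinite {i | ¬ R i x}).exists_maximalFor R _ ⟨b, hb⟩
  have hmax' : ∀ j, ¬ R j x → R j ≤ R a := fun j hj => (ht a j).elim (hmax hj) id
  have hx : ∀ j, j ≠ a → (R j x ↔ R a ≤ R j) := fun j hj =>
    ⟨fun h => (ht a j).elim id fun h' => absurd (h' x h) ha, fun h => by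
      by_contra hc
      exact hj (hR (le_antisymm (hmax' j hc) h))⟩
  have hay : R a y := hmax' b hb y hb'
  refine ⟨a, ha, hay, ?_⟩
  by_cases hbot : ∀ j, R a ≤ R j
  · exact ⟨y, .inl rfl, ha, hay, fun j hj => iff_of_true ((hx j hj).2 (hbot j)) (hbot j y hay)⟩
  push Not at hbot
  obtain ⟨j, hj⟩ := hbot
  have hja := (ht a j).resolve_left hj
  obtain ⟨z, hz, p, hp⟩ := h a j (by
    by_contra! hc
    exact hj fun k => (hc k).1)
  have hp : Covers R p a z := by
    rcases hp with hp | hp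
    · exact absurd (iff_of_false hp.1 fun h => hp.1 (hja z h)) hz
    · exact hp
  refine ⟨z, .inr ⟨⟨a, hp.2.1⟩, p, hp.1⟩, ha, hp.2.1, fun i hi => (hx i hi).trans
    ⟨fun h => h z hp.2.1, fun h l hl => ?_⟩⟩
  by_cases e : l = z
  · exact e ▸ h
  · exact (ht i p).elim (fun h' => absurd (h' z h) hp.1) fun h' => h' l ((hp.2.2 l e).2 hl)

theorem exists_step_flip_of_total [Finite ι] (hR : Function.Injective R)
    (ht : ∀ i j, R i ≤ R j ∨ R j ≤ R i) (h : Steps R) {x y : κ} (hxy : ∃ i, ¬ (R i x ↔ R i y)) :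
    ∃ i, ¬ (R i x ↔ R i y) ∧ ∃ z, (z = y ∨ (∃ i, R i z) ∧ ∃ i, ¬ R i z) ∧
      (Covers (flip R) x z i ∨ Covers (flip R) z x i) := by
  obtain ⟨i, hi⟩ := hxy
  by_cases hix : R i x
  · have hneg : ∀ i j, R i ≤ R j → (fun k => ¬ R j k) ≤ fun k => ¬ R i k :=
      fun i j hij k hk hk' => hk (hij k hk')
    obtain ⟨j, h1, h2, z, h3, h4⟩ := exists_covers_flip_of_total (R := fun i k => ¬ R i k)
      (injective_not hR)
      (fun a b => (ht a b).symm.imp (hneg _ _) (hneg _ _)) h.not (x := x) (y := y)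
      ⟨i, not_not.2 hix, by tauto⟩
    exact ⟨j, by tauto, z, by simpa [and_comm] using h3, .inr (covers_flip_not.1 h4)⟩
  · obtain ⟨j, h1, h2, z, h3, h4⟩ := exists_covers_flip_of_total hR ht h (x := x) (y := y)
      ⟨i, hix, by tauto⟩
    exact ⟨j, by tauto, z, h3, .inl h4⟩

end Relation

end SetSystem
namespace SetSystem

/-! ### Well-graded families as stepping families -/

section Families

variable {α : Type*} [DecidableEq α]

/-- From each member of `H` one can move inside `H` towards any different member by adding or
removing one element. -/
def IsStepping (H : Finset (Finset α)) : Prop :=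
  ∀ A ∈ H, ∀ B ∈ H, A ≠ B →
    ∃ x, (x ∈ A ∧ x ∉ B ∧ A.erase x ∈ H) ∨ (x ∉ A ∧ x ∈ B ∧ insert x A ∈ H)

theorem underlying_adj {H : Finset (Finset α)} {A B : H} :
    (oneInclusionGraph H).underlying.Adj A B ↔
      ∃ x, (x ∉ A.1 ∧ B.1 = insert x A.1) ∨ (x ∉ B.1 ∧ A.1 = insert x B.1) := by
  simp only [LabelledDigraph.underlying, oneInclusionGraph, exists_or]

theorem exists_flip_of_adj {H : Finset (Finset α)} {A C : H}
    (h : (oneInclusionGraph H).underlying.Adj A C) :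
    ∃ x, (x ∈ C.1 ↔ x ∉ A.1) ∧ ∀ y, y ≠ x → (y ∈ A.1 ↔ y ∈ C.1) := by
  obtain ⟨x, ⟨h1, h2⟩ | ⟨h1, h2⟩⟩ := underlying_adj.1 h <;> refine ⟨x, ?_⟩ <;> rw [h2] <;>
    simp only [Finset.mem_insert] <;> grind

theorem card_symmDiff_le_of_adj {H : Finset (Finset α)} {A C : H}
    (h : (oneInclusionGraph H).underlying.Adj A C) (B : Finset α) :
    (symmDiff A.1 B).card ≤ (symmDiff C.1 B).card + 1 := by
  obtain ⟨x, -, hx⟩ := exists_flip_of_adj h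
  refine (Finset.card_le_card fun y hy => ?_).trans (Finset.card_insert_le x _)
  simp only [Finset.mem_insert, Finset.mem_symmDiff] at hy ⊢
  have := hx y
  tauto

theorem card_symmDiff_le_length {H : Finset (Finset α)} {A B : H}
    (p : (oneInclusionGraph H).underlying.Walk A B) : (symmDiff A.1 B.1).card ≤ p.length := by
  induction p with
  | nil => simp
  | cons h p ih =>
    rw [SimpleGraph.Walk.length_cons]
    exact (card_symmDiff_le_of_adj h _).trans (by omega)

theorem isWellGraded_iff {H : Finset (Finset α)} : IsWellGraded H ↔ IsStepping H := by
  constructor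
  · intro h A hA B hB hne
    obtain ⟨p, hp⟩ := SimpleGraph.exists_walk_of_edist_eq_coe (h ⟨A, hA⟩ ⟨B, hB⟩)
    cases p with
    | nil => exact absurd rfl hne
    | @cons _ C _ hadj p =>
      have hle := card_symmDiff_le_length p
      rw [SimpleGraph.Walk.length_cons] at hp
      obtain ⟨x, hx, hx'⟩ := exists_flip_of_adj hadj
      have hC : symmDiff A {x} = C.1 := by
        ext y
        have := hx' y
        rw [Finset.mem_symmDiff, Finset.mem_singleton]
        by_cases e : y = x
        · subst e; tauto
        · tauto
      -- The first step of a geodesic must approach `B`; otherwise the rest of the walk would be too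
      -- short to reach `B`.
      have hmem : x ∉ symmDiff C.1 B := by
        intro hmem
        have : symmDiff A B ⊆ (symmDiff C.1 B).erase x := by
          intro y hy
          have := hx' y
          simp only [Finset.mem_erase, Finset.mem_symmDiff] at hy hmem ⊢
          refine ⟨?_, ?_⟩
          · rintro rfl; tauto
          · by_cases e : y = x
            · subst e; tauto
            · tauto
        have := Finset.card_le_card this
        rw [Finset.card_erase_of_mem hmem] at this
        have := Finset.card_pos.2 ⟨x, hmem⟩
        simp only at hp hle
        omega
      refine ⟨x, ?_⟩
      have hCH := C.2
      rw [← hC] at hCH hmem hx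
      simp only [Finset.mem_symmDiff, Finset.mem_singleton] at hmem
      by_cases hxA : x ∈ A
      · left
        refine ⟨hxA, by tauto, ?_⟩
        rwa [symmDiff_of_ge (by simpa using hxA), Finset.sdiff_singleton_eq_erase] at hCH
      · right
        refine ⟨hxA, by tauto, ?_⟩
        rwa [Disjoint.symmDiff_eq_sup (by simpa using hxA), Finset.sup_eq_union,
          Finset.union_comm, ← Finset.insert_eq] at hCH
  · intro h A B
    refine le_antisymm ?_ ?_
    · induction hn : (symmDiff A.1 B.1).card generalizing A with
      | zero =>
        have : A = B := Subtype.ext (symmDiff_eq_bot.1 (Finset.card_eq_zero.1 hn))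
        simp [this]
      | succ n ih =>
        have hne : A.1 ≠ B.1 := by
          intro e
          simp [e] at hn
        obtain ⟨x, hx⟩ := h A.1 A.2 B.1 B.2 hne
        obtain ⟨C, hadj, hC⟩ : ∃ C : H, (oneInclusionGraph H).underlying.Adj A C ∧
            symmDiff C.1 B.1 = (symmDiff A.1 B.1).erase x ∧ x ∈ symmDiff A.1 B.1 := by
          rcases hx with ⟨h1, h2, h3⟩ | ⟨h1, h2, h3⟩
          · refine ⟨⟨_, h3⟩, underlying_adj.2 ⟨x, .inr ⟨by simp, by simp [Finset.insert_erase h1]⟩⟩, ?_, ?_⟩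
            · ext y; simp only [Finset.mem_erase, Finset.mem_symmDiff]; grind
            · simp [Finset.mem_symmDiff, h1, h2]
          · refine ⟨⟨_, h3⟩, underlying_adj.2 ⟨x, .inl ⟨h1, rfl⟩⟩, ?_, ?_⟩
            · ext y; simp only [Finset.mem_erase, Finset.mem_symmDiff, Finset.mem_insert]; grind
            · simp [Finset.mem_symmDiff, h1, h2]
        have := ih C (by rw [hC.1, Finset.card_erase_of_mem hC.2, hn]; rfl)
        refine SimpleGraph.edist_triangle.trans ((add_le_add
          (SimpleGraph.edist_eq_one_iff_adj.2 hadj).le this).trans ?_)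
        push_cast
        rw [add_comm]
    · by_cases ht : (oneInclusionGraph H).underlying.edist A B = ⊤
      · simp [ht]
      · obtain ⟨p, hp⟩ := SimpleGraph.exists_walk_of_edist_ne_top ht
        rw [← hp]
        exact_mod_cast card_symmDiff_le_length p

theorem covers_iff_insert {ι : Type*} {f : ι → Finset α} {i j : ι} {a : α} :
    Covers (fun i a => a ∈ f i) i j a ↔ a ∉ f i ∧ f j = insert a (f i) := by
  unfold Covers
  refine and_congr_right fun h => ⟨fun ⟨h1, h2⟩ => ?_, fun e => ?_⟩
  · ext l
    rw [Finset.mem_insert]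
    by_cases e : l = a
    · subst e; simp [h1]
    · simp [e, h2 l e]
  · beta_reduce
    rw [e]
    exact ⟨Finset.mem_insert_self _ _, fun l hl => by simp [hl]⟩

theorem isStepping_iff {ι : Type*} {f : ι → Finset α} {H : Finset (Finset α)}
    (hH : ∀ s, s ∈ H ↔ ∃ i, f i = s) : IsStepping H ↔ Steps fun i a => a ∈ f i := by
  simp only [IsStepping, Steps, covers_iff_insert]
  constructor
  · intro h i j hij
    obtain ⟨x, hx⟩ := h (f i) ((hH _).2 ⟨i, rfl⟩) (f j) ((hH _).2 ⟨j, rfl⟩)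
      (fun e => by simp [e] at hij)
    rcases hx with ⟨h1, h2, h3⟩ | ⟨h1, h2, h3⟩ <;> obtain ⟨c, hc⟩ := (hH _).1 h3
    · exact ⟨x, by tauto, c, .inr ⟨by simp [hc], by rw [hc, Finset.insert_erase h1]⟩⟩
    · exact ⟨x, by tauto, c, .inl ⟨h1, hc⟩⟩
  · intro h A hA B hB hne
    obtain ⟨i, rfl⟩ := (hH _).1 hA
    obtain ⟨j, rfl⟩ := (hH _).1 hB
    obtain ⟨x, hx, c, hc⟩ := h i j (by
      by_contra! hc
      exact hne (Finset.ext hc))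
    refine ⟨x, ?_⟩
    rcases hc with ⟨h1, h2⟩ | ⟨h1, h2⟩
    · exact .inr ⟨h1, by tauto, (hH _).2 ⟨c, h2⟩⟩
    · have h3 : x ∈ f i := h2 ▸ Finset.mem_insert_self _ _
      exact .inl ⟨h3, by tauto, (hH _).2 ⟨c, by rw [h2, Finset.erase_insert h1]⟩⟩

/-- The incidence relation between the members of a family and the elements. -/
abbrev Incidence (F : Finset (Finset α)) : F → α → Prop := fun A x => x ∈ A.1

omit [DecidableEq α] in
theorem incidence_injective (F : Finset (Finset α)) : Function.Injective (Incidence F) :=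
  fun _ _ h => Subtype.ext (Finset.ext fun x => iff_of_eq (congrFun h x))

omit [DecidableEq α] in
theorem incidence_le {F : Finset (Finset α)} {A B : F} :
    Incidence F A ≤ Incidence F B ↔ A.1 ⊆ B.1 := Iff.rfl

theorem isWellGraded_iff_steps {F : Finset (Finset α)} :
    IsWellGraded F ↔ Steps (Incidence F) :=
  isWellGraded_iff.trans (isStepping_iff (f := Subtype.val) (by simp))

theorem isStepping_dual_iff [Fintype α] {F : Finset (Finset α)} :
    IsStepping (dual F) ↔ Steps (flip (Incidence F)) := by
  rw [isStepping_iff (f := dualSet F) (by simp [dual])]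
  simp only [dualSet, Finset.mem_filter, Finset.mem_univ, true_and]
  rfl

theorem isStepping_essDual_iff [Fintype α] {F : Finset (Finset α)} :
    IsStepping (essDual F) ↔ Steps fun (x : ess F) (A : F) => x.1 ∈ A.1 := by
  rw [isStepping_iff (f := fun x : ess F => dualSet F x) (by simp [essDual])]
  simp only [dualSet, Finset.mem_filter, Finset.mem_univ, true_and]

/-! ### Counting members against essential elements -/

theorem mem_ess [Fintype α] {H : Finset (Finset α)} {x : α} :
    x ∈ ess H ↔ (∃ A ∈ H, x ∈ A) ∧ ∃ B ∈ H, x ∉ B := by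
  simp [ess]

/-- Each element is added to at most one member of `H` inside `H`. -/
def HasDistinctLabels (H : Finset (Finset α)) : Prop :=
  ∀ x A B, x ∉ A → x ∉ B → A ∈ H → insert x A ∈ H → B ∈ H → insert x B ∈ H → A = B

theorem HasDistinctLabels.distinctLabels {ι : Type*} {f : ι → Finset α} {H : Finset (Finset α)}
    (h : HasDistinctLabels H) (hH : ∀ i, f i ∈ H) : DistinctLabels fun i a => a ∈ f i := by
  intro i j i' j' k h1 h2
  rw [covers_iff_insert] at h1 h2
  have := h k (f i) (f i') h1.1 h2.1 (hH i) (h1.2 ▸ hH j) (hH i') (h2.2 ▸ hH j')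
  simp [this]

open Finset in
-- Erasing `x` maps at most two members to one set, and exactly two when they are the ends of an
-- edge labelled `x`.
theorem card_eq_card_image_erase_add (H : Finset (Finset α)) (x : α) :
    #H = #(H.image fun s => s.erase x) + #{A ∈ H | x ∉ A ∧ insert x A ∈ H} := by
  rw [← memberSubfamily_union_nonMemberSubfamily,
    ← card_memberSubfamily_add_card_nonMemberSubfamily x H, ← card_union_add_card_inter]
  congr 2
  ext A
  simp only [mem_inter, mem_memberSubfamily, mem_nonMemberSubfamily, mem_filter]
  tauto

theorem ess_image_erase [Fintype α] (H : Finset (Finset α)) (x : α) :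
    ess (H.image fun s => s.erase x) = (ess H).erase x := by
  ext y
  simp only [mem_ess, Finset.mem_erase, Finset.exists_mem_image]
  grind

theorem IsStepping.image_erase {H : Finset (Finset α)} (h : IsStepping H) (x : α) :
    IsStepping (H.image fun s => s.erase x) := by
  have key : ∀ A ∈ H, ∀ B ∈ H, A.erase x ≠ B.erase x → ∃ A' ∈ H, A'.erase x = A.erase x ∧
      ∃ y, y ≠ x ∧ ((y ∈ A' ∧ y ∉ B ∧ A'.erase y ∈ H) ∨ (y ∉ A' ∧ y ∈ B ∧ insert y A' ∈ H)) := by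
    intro A hA B hB hne
    obtain ⟨y, hy⟩ := h A hA B hB (fun e => hne (e ▸ rfl))
    -- A step that changes `x` is invisible after erasure. It makes the membership of `x` agree with
    -- `B`, so the next step changes another element.
    by_cases e : y = x
    · subst e
      obtain ⟨A', hA', e', hy'⟩ : ∃ A' ∈ H, A'.erase y = A.erase y ∧ (y ∈ A' ↔ y ∈ B) := by
        rcases hy with ⟨h1, h2, h3⟩ | ⟨h1, h2, h3⟩
        · exact ⟨_, h3, by simp, by simp [h2]⟩
        · exact ⟨_, h3, by simp, by simp [h2]⟩
      obtain ⟨w, hw⟩ := h A' hA' B hB (fun e => hne (by rw [← e', e]))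
      exact ⟨A', hA', e', w, by rintro rfl; tauto, hw⟩
    · exact ⟨A, hA, rfl, y, e, hy⟩
  simp only [IsStepping, Finset.forall_mem_image]
  intro A hA B hB hne
  obtain ⟨A', hA', e, y, hyx, hy⟩ := key A hA B hB hne
  refine ⟨y, ?_⟩
  rw [← e]
  rcases hy with ⟨h1, h2, h3⟩ | ⟨h1, h2, h3⟩
  · exact .inl ⟨by simp [hyx, h1], by simp [h2], Finset.mem_image.2 ⟨_, h3, Finset.erase_right_comm⟩⟩
  · exact .inr ⟨by simp [h1], by simp [hyx, h2], Finset.mem_image.2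
      ⟨_, h3, Finset.erase_insert_of_ne hyx⟩⟩

open Finset in
theorem IsStepping.card_labels_pos [Fintype α] {H : Finset (Finset α)} (h : IsStepping H) {x : α}
    (hx : x ∈ ess H) : 0 < #{A ∈ H | x ∉ A ∧ insert x A ∈ H} := by
  obtain ⟨⟨B, hB, hxB⟩, A, hA, hxA⟩ := mem_ess.1 hx
  obtain ⟨e, e', he, -⟩ := ((isStepping_iff (f := Subtype.val) (by simp)).1 h).exists_covers
    (j := ⟨B, hB⟩) (k := x) hxB ⟨A, hA⟩ hxA
  obtain ⟨h1, h2⟩ := covers_iff_insert.1 he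
  exact card_pos.2 ⟨e.1, mem_filter.2 ⟨e.2, h1, h2 ▸ e'.2⟩⟩

/-- Erasing an essential `x` lowers the number of essential elements by exactly one and the number
of members by the number of `x`-edges, which is positive. -/
theorem IsStepping.card_ess_lt [Fintype α] {H : Finset (Finset α)} (h : IsStepping H)
    (hH : H.Nonempty) : (ess H).card < H.card := by
  induction hn : (ess H).card generalizing H with
  | zero => exact hH.card_pos
  | succ n ih =>
    obtain ⟨x, hx⟩ := Finset.card_pos.1 (n.succ_pos.trans_eq hn.symm)
    have h1 := ih (h.image_erase x) (hH.image _) (by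
      rw [ess_image_erase, Finset.card_erase_of_mem hx, hn]; rfl)
    have h2 := card_eq_card_image_erase_add H x
    have h3 := h.card_labels_pos hx
    omega

/-- After erasing `x`, `IsStepping.card_ess_lt` still leaves at least as many members as `H` had
essential elements, so at most one pair was merged. -/
theorem IsStepping.hasDistinctLabels [Fintype α] {H : Finset (Finset α)} (h : IsStepping H)
    (hc : H.card ≤ (ess H).card + 1) : HasDistinctLabels H := by
  intro x A B hA hB hAH hAH' hBH hBH'
  have hx : x ∈ ess H := mem_ess.2 ⟨⟨_, hAH', by simp⟩, _, hAH, hA⟩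
  have h1 := (h.image_erase x).card_ess_lt ⟨_, Finset.mem_image_of_mem _ hAH⟩
  rw [ess_image_erase, Finset.card_erase_of_mem hx] at h1
  have h2 := card_eq_card_image_erase_add H x
  have h3 : ({A ∈ H | x ∉ A ∧ insert x A ∈ H} : Finset _).card ≤ 1 := by omega
  exact Finset.card_le_one.1 h3 A (by simp [*]) B (by simp [*])

end Families

end SetSystem
namespace SetSystem

/-! ### Full chains -/

section Chain

variable {α : Type*} [DecidableEq α]

theorem chain_total_and_steps {l : List (Finset α)}
    (h : l.IsChain fun A B => A ⊆ B ∧ (B \ A).card = 1) :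
    (∀ A ∈ l, ∀ B ∈ l, A ⊆ B ∨ B ⊆ A) ∧ ∀ A ∈ l, ∀ B ∈ l, A ≠ B →
      ∃ x, (x ∈ A ∧ x ∉ B ∧ A.erase x ∈ l) ∨ (x ∉ A ∧ x ∈ B ∧ insert x A ∈ l) := by
  induction l with
  | nil => simp
  | cons a l ih =>
    cases l with
    | nil => simp
    | cons b l =>
      obtain ⟨⟨hab, hcard⟩, hl⟩ := List.isChain_cons_cons.1 h
      obtain ⟨ih1, ih2⟩ := ih hl
      have hb : ∀ B ∈ b :: l, b ⊆ B := by
        have := (hl.imp (S := (· ⊆ ·)) fun _ _ h => h.1).pairwise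
        intro B hB
        rcases List.mem_cons.1 hB with rfl | hB
        · exact Finset.Subset.refl _
        · exact List.rel_of_pairwise_cons this hB
      obtain ⟨x, hx⟩ := Finset.card_eq_one.1 hcard
      have hxba : x ∈ b \ a := hx ▸ Finset.mem_singleton_self x
      rw [Finset.mem_sdiff] at hxba
      have hins : insert x a = b := by
        rw [Finset.insert_eq, ← hx, Finset.sdiff_union_of_subset hab]
      have her : b.erase x = a := by rw [← hins, Finset.erase_insert hxba.2]
      constructor
      · intro A hA B hB
        rcases List.mem_cons.1 hA with rfl | hA' <;> rcases List.mem_cons.1 hB with rfl | hB'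
        · exact .inl (Finset.Subset.refl _)
        · exact .inl (hab.trans (hb B hB'))
        · exact .inr (hab.trans (hb A hA'))
        · exact ih1 A hA' B hB'
      · intro A hA B hB hne
        rcases List.mem_cons.1 hA with rfl | hA' <;> rcases List.mem_cons.1 hB with rfl | hB'
        · exact absurd rfl hne
        · exact ⟨x, .inr ⟨hxba.2, hb B hB' hxba.1, by simp [hins]⟩⟩
        · by_cases e : A = b
          · subst e
            exact ⟨x, .inl ⟨hxba.1, hxba.2, by simp [her]⟩⟩
          -- Since `A` contains `b`, a step from `A` towards `b` removes an element outside `b`,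
          -- hence outside the head `a`.
          · obtain ⟨y, hy⟩ := ih2 A hA' b (by simp) e
            rcases hy with ⟨h1, h2, h3⟩ | ⟨h1, h2, -⟩
            · exact ⟨y, .inl ⟨h1, fun h => h2 (hab h), List.mem_cons_of_mem _ h3⟩⟩
            · exact absurd (hb A hA' h2) h1
        · obtain ⟨y, hy⟩ := ih2 A hA' B hB' hne
          exact ⟨y, hy.imp (fun h => ⟨h.1, h.2.1, List.mem_cons_of_mem _ h.2.2⟩)
            fun h => ⟨h.1, h.2.1, List.mem_cons_of_mem _ h.2.2⟩⟩

theorem exists_chain_of_total {F : Finset (Finset α)} (hF : F.Nonempty)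
    (ht : ∀ A ∈ F, ∀ B ∈ F, A ⊆ B ∨ B ⊆ A) (hs : IsStepping F) :
    ∃ m l, (m :: l : List (Finset α)).Nodup ∧ (m :: l).toFinset = F ∧
      (m :: l).IsChain (fun A B => A ⊆ B ∧ (B \ A).card = 1) ∧ ∀ A ∈ F, m ⊆ A := by
  induction hn : F.card using Nat.strong_induction_on generalizing F with
  | _ n ih =>
    obtain ⟨m, hmF, hm'⟩ := F.exists_minimal hF
    have hm : ∀ A ∈ F, m ⊆ A := fun A hA => (ht m hmF A hA).elim id fun h => hm' hA h
    by_cases he : (F.erase m).Nonempty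
    · obtain ⟨b, l, h1, h2, h3, h4⟩ := ih _ (hn ▸ Finset.card_erase_lt_of_mem hmF) he
        (fun A hA B hB => ht A (Finset.mem_of_mem_erase hA) B (Finset.mem_of_mem_erase hB))
        (by
          intro A hA B hB hne
          rw [Finset.mem_erase] at hA hB
          obtain ⟨x, hx⟩ := hs A hA.2 B hB.2 hne
          -- A step between members other than `m` cannot land on `m`: going down it would squeeze
          -- `B` onto `m`, and going up it would put the new element into `m ⊆ A`.
          refine ⟨x, hx.imp (fun h => ⟨h.1, h.2.1, Finset.mem_erase.2 ⟨fun e => hB.1 ?_, h.2.2⟩⟩)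
            fun h => ⟨h.1, h.2.1, Finset.mem_erase.2 ⟨fun e => h.1 ?_, h.2.2⟩⟩⟩
          · refine Finset.Subset.antisymm ?_ (hm B hB.2)
            rw [← e]
            exact Finset.subset_erase.2
              ⟨(ht A hA.2 B hB.2).resolve_left fun h' => h.2.1 (h' h.1), h.2.1⟩
          · exact hm A hA.2 (e ▸ Finset.mem_insert_self _ _)) rfl
      have hbF : b ∈ F.erase m := by rw [← h2]; simp
      rw [Finset.mem_erase] at hbF
      have hmb := hm b hbF.2
      obtain ⟨x, ⟨h5, h6, -⟩ | ⟨h5, h6, h7⟩⟩ := hs m hmF b hbF.2 hbF.1.symm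
      · exact absurd (hmb h5) h6
      have hbx : b = insert x m := by
        refine Finset.Subset.antisymm (h4 _ (Finset.mem_erase.2 ⟨?_, h7⟩))
          (Finset.insert_subset h6 hmb)
        intro e
        exact h5 (e ▸ Finset.mem_insert_self _ _)
      refine ⟨m, b :: l, List.nodup_cons.2 ⟨fun h => ?_, h1⟩, ?_,
        List.isChain_cons_cons.2 ⟨⟨hmb, ?_⟩, h3⟩, hm⟩
      · rw [← List.mem_toFinset, h2] at h
        simp at h
      · rw [List.toFinset_cons, h2, Finset.insert_erase hmF]
      · rw [hbx, Finset.insert_sdiff_cancel h5, Finset.card_singleton]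
    · refine ⟨m, [], by simp, ?_, by simp, hm⟩
      rw [Finset.not_nonempty_iff_eq_empty, Finset.erase_eq_empty_iff] at he
      rcases he with he | he
      · simp [he] at hmF
      · simp [he]

theorem isFullChainSystem_iff {F : Finset (Finset α)} (hF : F.Nonempty) :
    IsFullChainSystem F ↔ (∀ A ∈ F, ∀ B ∈ F, A ⊆ B ∨ B ⊆ A) ∧ IsWellGraded F := by
  rw [isWellGraded_iff]
  constructor
  · rintro ⟨l, -, rfl, h⟩
    simpa [IsStepping] using chain_total_and_steps h
  · rintro ⟨h1, h2⟩
    obtain ⟨m, l, h3, h4, h5, -⟩ := exists_chain_of_total hF h1 h2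
    exact ⟨m :: l, h3, h4, h5⟩

omit [DecidableEq α] in
theorem incidence_total {F : Finset (Finset α)} :
    (∀ A B, Incidence F A ≤ Incidence F B ∨ Incidence F B ≤ Incidence F A) ↔
      ∀ A ∈ F, ∀ B ∈ F, A ⊆ B ∨ B ⊆ A := by
  simp only [incidence_le, Subtype.forall]

variable [Fintype α] {F : Finset (Finset α)}

theorem IsFullChainSystem.isSelfAndDualWellGraded (hF : F.Nonempty) (h : IsFullChainSystem F) :
    IsSelfAndDualWellGraded F := by
  obtain ⟨ht, hw⟩ := (isFullChainSystem_iff hF).1 h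
  refine ⟨hw, isWellGraded_iff.2 (isStepping_dual_iff.2 fun x y hxy => ?_)⟩
  obtain ⟨A, hA, z, -, hz⟩ := exists_step_flip_of_total (incidence_injective F)
    (incidence_total.2 ht) (isWellGraded_iff_steps.1 hw) hxy
  exact ⟨A, hA, z, hz⟩

theorem IsFullChainSystem.isSelfAndEssDualWellGraded (hF : F.Nonempty)
    (h : IsFullChainSystem F) : IsSelfAndEssDualWellGraded F := by
  obtain ⟨ht, hw⟩ := (isFullChainSystem_iff hF).1 h
  refine ⟨hw, isWellGraded_iff.2 (isStepping_essDual_iff.2 fun x y hxy => ?_)⟩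
  obtain ⟨A, hA, z, hze, hz⟩ := exists_step_flip_of_total (incidence_injective F)
    (incidence_total.2 ht) (isWellGraded_iff_steps.1 hw) hxy
  have hze' : z ∈ ess F := by
    rcases hze with rfl | hze
    · exact y.2
    · simpa [mem_ess, Incidence] using hze
  exact ⟨A, hA, ⟨z, hze'⟩, hz⟩

end Chain

/-! ### Starlike trees -/

section Starlike

variable {α : Type*} [DecidableEq α] {F : Finset (Finset α)}

theorem edge_iff {A B : F} {b : α} :
    (oneInclusionGraph F).Edge A B b ↔ Covers (Incidence F) A B b :=
  (covers_iff_insert (f := Subtype.val)).symm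

theorem adj_iff_up {A B : F} : (oneInclusionGraph F).underlying.Adj A B ↔
    Up (Incidence F) A B ∨ Up (Incidence F) B A := by
  simp only [LabelledDigraph.underlying, edge_iff, Up]

theorem up_not {ι κ : Type*} {R : ι → κ → Prop} {i j : ι} :
    Up (fun i k => ¬ R i k) i j ↔ Up R j i := by
  simp only [Up, covers_not]

theorem IsWellGraded.reachable (h : IsWellGraded F) (A B : F) :
    (oneInclusionGraph F).underlying.Reachable A B :=
  SimpleGraph.reachable_of_edist_ne_top (by rw [h A B]; simp)

theorem IsWellGraded.connected (h : IsWellGraded F) (hF : F.Nonempty) :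
    (oneInclusionGraph F).underlying.Connected :=
  haveI := hF.to_subtype
  ⟨h.reachable⟩

theorem IsWellGraded.dist_eq (h : IsWellGraded F) (A B : F) :
    (oneInclusionGraph F).underlying.dist A B = (symmDiff A.1 B.1).card := by
  have := (h.reachable A B).coe_dist_eq_edist
  rw [h A B] at this
  exact_mod_cast this

/-- Every edge is a bridge: a walk between the ends of an `x`-edge must somewhere acquire `x`, and
only that edge does so. -/
theorem isAcyclic_of_distinctLabels (hD : DistinctLabels (Incidence F)) :
    (oneInclusionGraph F).underlying.IsAcyclic := by
  have key : ∀ {A B : F} {x}, Covers (Incidence F) A B x →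
      ∀ p : (oneInclusionGraph F).underlying.Walk A B, s(A, B) ∈ p.edges := by
    intro A B x h p
    obtain ⟨d, hd, h1, h2⟩ := p.exists_boundary_dart {C | x ∉ C.1} h.1 (by simpa using h.2.1)
    have h2 : x ∈ d.snd.1 := by simpa using h2
    have h3 : Covers (Incidence F) d.fst d.snd x := by
      rcases adj_iff_up.1 d.adj with ⟨y, hy⟩ | ⟨y, hy⟩
      · by_cases e : x = y
        · exact e ▸ hy
        · exact absurd ((hy.2.2 x e).2 h2) h1
      · exact absurd (hy.le x h2) h1
    have e1 := incidence_injective F (hD _ _ _ _ _ h3 h)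
    have e2 := incidence_injective F (h3.right_eq h (hD _ _ _ _ _ h3 h))
    have e3 : s(A, B) = d.edge := by rw [← e1, ← e2]; rfl
    rw [e3]
    exact List.mem_map_of_mem hd
  rw [SimpleGraph.isAcyclic_iff_forall_adj_isBridge]
  intro A B hAB
  rw [SimpleGraph.isBridge_iff_forall_walk_mem_edges]
  intro p
  rcases adj_iff_up.1 hAB with ⟨x, hx⟩ | ⟨x, hx⟩
  · exact key hx p
  · have := key hx p.reverse
    rw [SimpleGraph.Walk.edges_reverse, List.mem_reverse, Sym2.eq_swap] at this
    exact this

theorem isStarlike_of_unique (h : IsWellGraded F) (hD : DistinctLabels (Incidence F)) {c : F}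
    (hd : 2 ≤ (oneInclusionGraph F).degree c)
    (hs : (oneInclusionGraph F).IsSource c ∨ (oneInclusionGraph F).IsSink c)
    (h1 : ∀ A, A ≠ c → ∀ B B', Up (Incidence F) A B → Up (Incidence F) A B' → B = B')
    (h2 : ∀ A, A ≠ c → ∀ B B', Up (Incidence F) B A → Up (Incidence F) B' A → B = B') :
    (oneInclusionGraph F).IsStarlike c := by
  refine ⟨⟨h.connected ⟨c.1, c.2⟩, isAcyclic_of_distinctLabels hD⟩, ?_, hd, hs, ?_⟩
  · intro A B A' B' x hx hx'
    rw [edge_iff] at hx hx'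
    have := hD _ _ _ _ _ hx hx'
    exact ⟨incidence_injective F this, incidence_injective F (hx.right_eq hx' this)⟩
  · intro A hA
    have hsub : (oneInclusionGraph F).underlying.neighborSet A ⊆
        {B | Up (Incidence F) A B} ∪ {B | Up (Incidence F) B A} := fun B hB => adj_iff_up.1 hB
    refine (Set.encard_le_encard hsub).trans ((Set.encard_union_le _ _).trans ?_)
    rw [← one_add_one_eq_two]
    exact add_le_add (Set.encard_le_one_iff.2 fun _ _ hB hB' => h1 A hA _ _ hB hB')
      (Set.encard_le_one_iff.2 fun _ _ hB hB' => h2 A hA _ _ hB hB')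

theorem IsWellGraded.isSource (h : IsWellGraded F) (h0 : ∅ ∈ F) :
    (oneInclusionGraph F).IsSource ⟨∅, h0⟩ := by
  refine ⟨h.connected ⟨_, h0⟩, fun A B b hb => ?_⟩
  have hc : B.1 = insert b A.1 := hb.2
  have hb' : b ∉ A.1 := hb.1
  rw [h.dist_eq, h.dist_eq, hc]
  simp only [← Finset.bot_eq_empty, symmDiff_bot]
  rw [Finset.card_insert_of_notMem hb']
  exact Nat.lt_succ_self _

theorem IsWellGraded.isSink [Fintype α] (h : IsWellGraded F) (h1 : Finset.univ ∈ F) :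
    (oneInclusionGraph F).IsSink ⟨Finset.univ, h1⟩ := by
  refine ⟨h.connected ⟨_, h1⟩, fun A B b hb => ?_⟩
  have hc : B.1 = insert b A.1 := hb.2
  have hb' : b ∉ A.1 := hb.1
  rw [h.dist_eq, h.dist_eq, hc]
  simp only [← Finset.top_eq_univ, symmDiff_top]
  refine Finset.card_lt_card (Finset.compl_ssubset_compl.2 (Finset.ssubset_insert hb'))

/-- The first step of a geodesic to `c` cannot increase the distance, so it ends at a parent. The
parent uses one of at most two neighbours, leaving room for one successor. -/
theorem parents_and_up_unique_of_dist {V : Type*} {T : SimpleGraph V} {E : V → V → Prop}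
    (hE : ∀ v w, T.Adj v w ↔ E v w ∨ E w v) (hT : T.Connected) {c : V}
    (hs : ∀ v w, E v w → T.dist v c < T.dist w c)
    (hdeg : ∀ v, v ≠ c → (T.neighborSet v).encard ≤ 2) :
    (∀ v, v ≠ c → ∃ w, E w v) ∧ ∀ v, v ≠ c → ∀ w w', E v w → E v w' → w = w' := by
  have hP : ∀ v, v ≠ c → ∃ w, E w v := by
    intro v hv
    obtain ⟨p, hp⟩ := hT.exists_walk_length_eq_dist v c
    cases p with
    | nil => exact absurd rfl hv
    | @cons _ w _ hadj p =>
      have := SimpleGraph.dist_le p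
      rw [SimpleGraph.Walk.length_cons] at hp
      rcases (hE v w).1 hadj with h | h
      · have := hs v w h
        omega
      · exact ⟨w, h⟩
  refine ⟨hP, fun v hv w w' hw hw' => ?_⟩
  obtain ⟨u, hu⟩ := hP v hv
  by_contra hne
  have h1 := hs _ _ hu
  have h2 := hs _ _ hw
  have h3 := hs _ _ hw'
  have hsub : ({u, w, w'} : Set V) ⊆ T.neighborSet v := by
    rintro x (rfl | rfl | rfl)
    · exact (hE _ _).2 (.inr hu)
    · exact (hE _ _).2 (.inl hw)
    · exact (hE _ _).2 (.inl hw')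
  have h4 := (Set.encard_le_encard hsub).trans (hdeg v hv)
  rw [Set.encard_insert_of_notMem, Set.encard_pair hne] at h4
  · exact absurd h4 (by decide)
  · rintro (rfl | rfl) <;> omega

theorem distinctLabels_of_labelsDistinct (h : (oneInclusionGraph F).LabelsDistinct) :
    DistinctLabels (Incidence F) := fun _ _ _ _ _ h1 h2 => by
  rw [(h _ _ _ _ _ (edge_iff.2 h1) (edge_iff.2 h2)).1]

theorem isSelfAndDualWellGraded_iff [Fintype α] : IsSelfAndDualWellGraded F ↔
    Steps (Incidence F) ∧ Steps (flip (Incidence F)) :=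
  and_congr isWellGraded_iff_steps (isWellGraded_iff.trans isStepping_dual_iff)

theorem IsUpwardStarlike.isSelfAndDualWellGraded [Fintype α] (h : IsUpwardStarlike F) :
    IsSelfAndDualWellGraded F := by
  obtain ⟨⟨h0, ⟨-, hL, -, -, hdeg⟩, hc, hs⟩, z, hz⟩ := h
  obtain ⟨hP, hU⟩ := parents_and_up_unique_of_dist (E := Up (Incidence F))
    (fun _ _ => adj_iff_up) hc (fun v w ⟨l, hl⟩ => hs v w l (edge_iff.2 hl)) hdeg
  have hm : ∀ k, ¬ Incidence F ⟨∅, h0⟩ k := fun k => Finset.notMem_empty k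
  have hD := distinctLabels_of_labelsDistinct hL
  rw [isSelfAndDualWellGraded_iff]
  exact ⟨steps_of_star (incidence_injective F) hm hP hD hU,
    steps_flip_of_star (incidence_injective F) hm hP hD hU (z := z) fun A => hz A.1 A.2⟩

theorem IsDownwardStarlike.isSelfAndDualWellGraded [Fintype α] (h : IsDownwardStarlike F) :
    IsSelfAndDualWellGraded F := by
  obtain ⟨⟨h1, ⟨-, hL, -, -, hdeg⟩, hc, hs⟩, z, hz⟩ := h
  obtain ⟨hP, hU⟩ := parents_and_up_unique_of_dist (E := Up fun A x => ¬ Incidence F A x)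
    (fun _ _ => by rw [adj_iff_up, up_not, up_not, or_comm]) hc
    (fun v w h => by
      obtain ⟨l, hl⟩ := up_not.1 h
      exact hs w v l (edge_iff.2 hl)) hdeg
  have hm : ∀ k, ¬ ¬ Incidence F ⟨Finset.univ, h1⟩ k := fun k => not_not.2 (Finset.mem_univ k)
  have hD := (distinctLabels_of_labelsDistinct hL).not
  have hR := injective_not (incidence_injective F)
  rw [isSelfAndDualWellGraded_iff]
  refine ⟨(steps_of_star hR hm hP hD hU).of_not, Steps.of_not (R := flip (Incidence F)) ?_⟩
  exact steps_flip_of_star hR hm hP hD hU (z := z) fun A => not_not.2 (hz A.1 A.2)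

end Starlike

end SetSystem
namespace SetSystem

/-! ### Uniqueness of predecessors and successors -/

section Unique

variable {ι κ : Type*} [Finite ι] [Finite κ] {R : ι → κ → Prop} (hR : Function.Injective R)
  (h : Steps R) (hD : DistinctLabels R) {m : ι} (hm : ∀ k, ¬ R m k)

omit [Finite ι] in
include hR h hD hm in
theorem up_left_unique (i : ι) (j j' : ι) (h1 : Up R j i) (h2 : Up R j' i) : j = j' := by
  obtain ⟨⟨k, h1⟩, k', h2⟩ := h1, h2
  obtain rfl := h.covers_down_unique hD hm h1 h2
  exact hR (hD _ _ _ _ _ h1 h2)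

include hR h hD hm in
theorem up_right_unique (h' : Steps (flip R)) (hD' : DistinctLabels (flip R)) {z : κ}
    (hz : ∀ i, ¬ R i z) (i : ι) (hi : i ≠ m) (j j' : ι) (h1 : Up R i j) (h2 : Up R i j') :
    j = j' := by
  obtain ⟨a, ha⟩ : ∃ a, R i a := by
    by_contra! hc
    exact hi (hR (funext fun k => propext (iff_of_false (hc k) (hm k))))
  obtain ⟨⟨k, h1⟩, k', h2⟩ := h1, h2
  obtain rfl := h.covers_up_unique hD h' hD' hm hz ha h1 h2
  exact hR (h1.right_eq h2 rfl)

end Unique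

/-! ### Tight counts and classification -/

section Main

variable {X : Type*} [DecidableEq X] {F : Finset (Finset X)}

theorem eq_of_adj_of_degree_lt_two {c A B : F} (hd : ¬ 2 ≤ (oneInclusionGraph F).degree c)
    (hA : (oneInclusionGraph F).underlying.Adj c A)
    (hB : (oneInclusionGraph F).underlying.Adj c B) : A = B := by
  rw [not_le, ← one_add_one_eq_two] at hd
  exact Set.encard_le_one_iff.1 (Order.le_of_lt_add_one hd) A B hA hB

theorem isFullChainSystem_of_steps (hF : F.Nonempty) (h : Steps (Incidence F))
    (ht : ∀ A B, Incidence F A ≤ Incidence F B ∨ Incidence F B ≤ Incidence F A) :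
    IsFullChainSystem F :=
  (isFullChainSystem_iff hF).2 ⟨incidence_total.1 ht, isWellGraded_iff_steps.2 h⟩

variable [Fintype X]

theorem eq_of_inter_ess {A B : Finset X} (hA : A ∈ F) (hB : B ∈ F)
    (h : ∀ x ∈ ess F, x ∈ A ↔ x ∈ B) : A = B := by
  ext x
  by_cases hx : x ∈ ess F
  · exact h x hx
  · rw [mem_ess] at hx
    exact ⟨fun h' => by_contra fun h'' => hx ⟨⟨A, hA, h'⟩, B, hB, h''⟩,
      fun h' => by_contra fun h'' => hx ⟨⟨B, hB, h'⟩, A, hA, h''⟩⟩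

theorem mem_ess_dual {A : F} :
    A ∈ ess (dual F) ↔ (∃ x, x ∈ A.1) ∧ ∃ x, x ∉ A.1 := by
  simp [mem_ess, dual, dualSet]

theorem mem_ess_essDual {A : F} :
    A ∈ ess (essDual F) ↔ (∃ x ∈ ess F, x ∈ A.1) ∧ ∃ x ∈ ess F, x ∉ A.1 := by
  rw [mem_ess]
  simp [essDual, dualSet]

/-- A member is essential for the essential dual unless it contains none or all of the essential
elements, and each exception occurs at most once. Combined with the strict bounds for `F` and
`essDual F`, this forces equality and makes both exceptions occur; they are the least and greatest
members. -/
theorem IsSelfAndEssDualWellGraded.card_eq_and_bounds (hF : F.Nonempty)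
    (h : IsSelfAndEssDualWellGraded F) :
    F.card = (ess F).card + 1 ∧ ∃ m M : F, ∀ A : F, m.1 ⊆ A.1 ∧ A.1 ⊆ M.1 := by
  obtain ⟨h1, h2⟩ := h
  rw [isWellGraded_iff] at h1 h2
  -- Without essential elements the essential dual is the empty family, for which the strict bound
  -- fails.
  rcases (ess F).eq_empty_or_nonempty with he | he
  · have heq : ∀ A ∈ F, ∀ B ∈ F, A = B := fun A hA B hB =>
      eq_of_inter_ess hA hB (by simp [he])
    obtain ⟨A, hA⟩ := hF
    refine ⟨?_, ⟨A, hA⟩, ⟨A, hA⟩, fun B => ?_⟩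
    · rw [he, Finset.card_empty, zero_add]
      exact le_antisymm (Finset.card_le_one.2 heq) (Finset.card_pos.2 ⟨A, hA⟩)
    · rw [heq B.1 B.2 A hA]
      exact ⟨Finset.Subset.refl _, Finset.Subset.refl _⟩
  have c1 := h1.card_ess_lt hF
  have c2 := h2.card_ess_lt (he.image _)
  have c3 : (essDual F).card ≤ (ess F).card := Finset.card_image_le
  set bot := F.filter fun A => ∀ x ∈ ess F, x ∉ A with hbot
  set top := F.filter fun A => ∀ x ∈ ess F, x ∈ A with htop
  have cb : bot.card ≤ 1 := Finset.card_le_one.2 fun A hA B hB => by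
    rw [hbot, Finset.mem_filter] at hA hB
    exact eq_of_inter_ess hA.1 hB.1 fun x hx => iff_of_false (hA.2 x hx) (hB.2 x hx)
  have ct : top.card ≤ 1 := Finset.card_le_one.2 fun A hA B hB => by
    rw [htop, Finset.mem_filter] at hA hB
    exact eq_of_inter_ess hA.1 hB.1 fun x hx => iff_of_true (hA.2 x hx) (hB.2 x hx)
  have hsub : F ⊆ (ess (essDual F)).image Subtype.val ∪ (bot ∪ top) := by
    intro A hA
    simp only [Finset.mem_union, Finset.mem_image, hbot, htop, Finset.mem_filter]
    by_contra! hc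
    obtain ⟨x, hx, hxA⟩ := hc.2.1 hA
    obtain ⟨y, hy, hyA⟩ := hc.2.2 hA
    exact hc.1 ⟨A, hA⟩ (mem_ess_essDual.2 ⟨⟨x, hx, hxA⟩, y, hy, hyA⟩) rfl
  have c4 := (Finset.card_le_card hsub).trans ((Finset.card_union_le _ _).trans
    (add_le_add Finset.card_image_le (Finset.card_union_le _ _)))
  refine ⟨by omega, ?_⟩
  obtain ⟨m, hm⟩ := Finset.card_pos.1 (by omega : 0 < bot.card)
  obtain ⟨M, hM⟩ := Finset.card_pos.1 (by omega : 0 < top.card)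
  rw [hbot, Finset.mem_filter] at hm
  rw [htop, Finset.mem_filter] at hM
  refine ⟨⟨m, hm.1⟩, ⟨M, hM.1⟩, fun A => ⟨fun x hx => ?_, fun x hx => ?_⟩⟩
  · by_contra hc
    exact hm.2 x (mem_ess.2 ⟨⟨m, hm.1, hx⟩, A.1, A.2, hc⟩) hx
  · by_contra hc
    exact hc (hM.2 x (mem_ess.2 ⟨⟨A.1, A.2, hx⟩, M, hM.1, hc⟩))

theorem IsWellGraded.distinctLabels (h : IsWellGraded F) (hc : F.card = (ess F).card + 1) :
    DistinctLabels (Incidence F) :=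
  ((isWellGraded_iff.1 h).hasDistinctLabels hc.le).distinctLabels (f := Subtype.val)
    fun A : F => A.2

theorem IsSelfAndEssDualWellGraded.isFullChainSystem (hF : F.Nonempty)
    (h : IsSelfAndEssDualWellGraded F) : IsFullChainSystem F := by
  obtain ⟨hc, m, M, hmM⟩ := h.card_eq_and_bounds hF
  have hs := isWellGraded_iff_steps.1 h.1
  exact isFullChainSystem_of_steps hF hs fun A B =>
    total_below hs (h.1.distinctLabels hc) (fun C => (hmM C).1) (hmM A).2 (hmM B).2

/-- The two exclusions allow at most two of the four conditions, while adding the four inequalities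
requires at least two. -/
theorem eq_add_one_of_card_bounds {p q r s : Prop} [Decidable p] [Decidable q] [Decidable r]
    [Decidable s] (hps : p → ¬ s) (hqr : q → ¬ r) {f f' d d' : ℕ} (h1 : f' < f) (h2 : d' < d)
    (h3 : d ≤ f' + ((if r then 1 else 0) + if s then 1 else 0))
    (h4 : f ≤ d' + ((if p then 1 else 0) + if q then 1 else 0)) :
    f = f' + 1 ∧ d = d' + 1 ∧ ((p ∧ q) ∨ (r ∧ s) ∨ (p ∧ r) ∨ (q ∧ s)) := by
  by_cases hp : p <;> by_cases hq : q <;> by_cases hr : r <;> by_cases hs : s <;>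
    simp_all <;> omega

theorem IsSelfAndDualWellGraded.card_eq [Nonempty X] (hF : F.Nonempty)
    (h : IsSelfAndDualWellGraded F) :
    F.card = (ess F).card + 1 ∧ (dual F).card = (ess (dual F)).card + 1 ∧
      ((∅ ∈ F ∧ Finset.univ ∈ F) ∨ ((∃ x, ∀ A ∈ F, x ∉ A) ∧ ∃ x, ∀ A ∈ F, x ∈ A) ∨
        (∅ ∈ F ∧ ∃ x, ∀ A ∈ F, x ∉ A) ∨ (Finset.univ ∈ F ∧ ∃ x, ∀ A ∈ F, x ∈ A)) := by
  classical
  obtain ⟨h1, h2⟩ := h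
  rw [isWellGraded_iff] at h1 h2
  have c1 := h1.card_ess_lt hF
  have c2 := h2.card_ess_lt (Finset.univ_nonempty.image _)
  have s3 : dual F ⊆ essDual F ∪ ((if ∃ x, ∀ A ∈ F, x ∉ A then {∅} else ∅) ∪
      if ∃ x, ∀ A ∈ F, x ∈ A then {Finset.univ} else ∅) := by
    intro S hS
    obtain ⟨x, -, rfl⟩ := Finset.mem_image.1 hS
    by_cases hx : x ∈ ess F
    · exact Finset.mem_union_left _ (Finset.mem_image_of_mem _ hx)
    refine Finset.mem_union_right _ (Finset.mem_union.2 ?_)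
    rw [mem_ess, not_and_or] at hx
    rcases hx with hx | hx <;> push Not at hx
    · left
      rw [if_pos ⟨x, hx⟩, Finset.mem_singleton, dualSet, Finset.filter_eq_empty_iff]
      exact fun A _ => hx A.1 A.2
    · right
      rw [if_pos ⟨x, hx⟩, Finset.mem_singleton, dualSet, Finset.filter_eq_self]
      exact fun A _ => hx A.1 A.2
  have s4 : F ⊆ (ess (dual F)).image Subtype.val ∪ ((if ∅ ∈ F then {∅} else ∅) ∪
      if Finset.univ ∈ F then {Finset.univ} else ∅) := by
    intro A hA
    by_cases h0 : A = ∅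
    · subst h0; simp [hA]
    by_cases hu : A = Finset.univ
    · subst hu; simp [hA]
    refine Finset.mem_union_left _ (Finset.mem_image.2 ⟨⟨A, hA⟩, mem_ess_dual.2 ⟨?_, ?_⟩, rfl⟩)
    · exact Finset.nonempty_iff_ne_empty.2 h0
    · simpa [Finset.eq_univ_iff_forall] using hu
  have c3 := (Finset.card_le_card s3).trans ((Finset.card_union_le _ _).trans
    (add_le_add Finset.card_image_le (Finset.card_union_le _ _)))
  have c4 := (Finset.card_le_card s4).trans ((Finset.card_union_le _ _).trans
    (add_le_add Finset.card_image_le (Finset.card_union_le _ _)))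
  have i1 : ∅ ∈ F → ¬ ∃ x, ∀ A ∈ F, x ∈ A := fun h ⟨x, hx⟩ => Finset.notMem_empty x (hx _ h)
  have i2 : Finset.univ ∈ F → ¬ ∃ x, ∀ A ∈ F, x ∉ A := fun h ⟨x, hx⟩ =>
    hx _ h (Finset.mem_univ x)
  simp only [apply_ite Finset.card, Finset.card_singleton, Finset.card_empty] at c3 c4
  exact eq_add_one_of_card_bounds i1 i2 c1 c2 c3 c4

theorem IsSelfAndDualWellGraded.classification [Nonempty X] (hF : F.Nonempty)
    (h : IsSelfAndDualWellGraded F) :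
    IsFullChainSystem F ∨ IsUpwardStarlike F ∨ IsDownwardStarlike F := by
  obtain ⟨hc, hc', hcases⟩ := h.card_eq hF
  have hw := h.1
  have hD := hw.distinctLabels hc
  have hR := incidence_injective F
  have hD' : DistinctLabels (flip (Incidence F)) := by
    have := ((isWellGraded_iff.1 h.2).hasDistinctLabels hc'.le).distinctLabels (f := dualSet F)
      fun x => Finset.mem_image_of_mem _ (Finset.mem_univ x)
    simp only [dualSet, Finset.mem_filter, Finset.mem_univ, true_and] at this
    exact this
  obtain ⟨hs, hs'⟩ := isSelfAndDualWellGraded_iff.1 h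
  rcases hcases with ⟨h0, h1⟩ | ⟨⟨z, hz⟩, o, ho⟩ | ⟨h0, z, hz⟩ | ⟨h1, o, ho⟩
  · refine .inl (isFullChainSystem_of_steps hF hs fun A B => ?_)
    exact total_below hs hD (m := ⟨∅, h0⟩) (c := ⟨Finset.univ, h1⟩)
      (fun C => Finset.empty_subset C.1) (Finset.subset_univ A.1) (Finset.subset_univ B.1)
  · refine .inl (isFullChainSystem_of_steps hF hs fun A B => ?_)
    -- Here the extremes lie in the dual, so the columns form a chain; two incomparable rows would
    -- yield two incomparable columns.
    have ht : ∀ x y, flip (Incidence F) x ≤ flip (Incidence F) y ∨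
        flip (Incidence F) y ≤ flip (Incidence F) x := fun x y =>
      total_below hs' hD' (m := z) (c := o) (fun _ C hC => absurd hC (hz C.1 C.2))
        (fun C _ => ho C.1 C.2) (fun C _ => ho C.1 C.2)
    rw [incidence_le, incidence_le]
    by_contra hcon
    rw [not_or, Finset.not_subset, Finset.not_subset] at hcon
    obtain ⟨⟨a, ha, ha'⟩, b, hb, hb'⟩ := hcon
    exact (ht a b).elim (fun h => hb' (h A ha)) fun h => ha' (h B hb)
  · have hm : ∀ k, ¬ Incidence F ⟨∅, h0⟩ k := fun k => Finset.notMem_empty k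
    have hz' : ∀ A, ¬ Incidence F A z := fun A => hz A.1 A.2
    have hU := up_right_unique hR hs hD hm hs' hD' hz'
    by_cases hd : 2 ≤ (oneInclusionGraph F).degree ⟨∅, h0⟩
    · exact .inr (.inl ⟨⟨h0, isStarlike_of_unique hw hD hd (.inl (hw.isSource h0)) hU
        fun A _ => up_left_unique hR hs hD hm A, hw.isSource h0⟩, z, hz⟩)
    -- With degree below 2 the centre does not branch either, so a single path leaves ∅.
    · refine .inl (isFullChainSystem_of_steps hF hs
        (total_of_up_unique (hs.exists_parent hR hm) fun A B B' hB hB' => ?_))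
      by_cases hA : A = ⟨∅, h0⟩
      · subst hA
        exact eq_of_adj_of_degree_lt_two hd (adj_iff_up.2 (.inl hB)) (adj_iff_up.2 (.inl hB'))
      · exact hU A hA B B' hB hB'
  · have hm : ∀ k, ¬ ¬ Incidence F ⟨Finset.univ, h1⟩ k := fun k => not_not.2 (Finset.mem_univ k)
    have hz' : ∀ A, ¬ ¬ Incidence F A o := fun A => not_not.2 (ho A.1 A.2)
    have hRn := injective_not hR
    have hU := up_right_unique hRn hs.not hD.not hm (Steps.not (R := flip (Incidence F)) hs')
      (DistinctLabels.not (R := flip (Incidence F)) hD') hz'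
    by_cases hd : 2 ≤ (oneInclusionGraph F).degree ⟨Finset.univ, h1⟩
    · refine .inr (.inr ⟨⟨h1, isStarlike_of_unique hw hD hd (.inr (hw.isSink h1)) ?_ ?_,
        hw.isSink h1⟩, o, ho⟩)
      · exact fun A _ B B' hB hB' =>
          up_left_unique hRn hs.not hD.not hm A B B' (up_not.2 hB) (up_not.2 hB')
      · exact fun A hA B B' hB hB' => hU A hA B B' (up_not.2 hB) (up_not.2 hB')
    · have ht := total_of_up_unique (hs.not.exists_parent hRn hm) fun A B B' hB hB' => by
        by_cases hA : A = ⟨Finset.univ, h1⟩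
        · subst hA
          exact eq_of_adj_of_degree_lt_two hd (adj_iff_up.2 (.inr (up_not.1 hB)))
            (adj_iff_up.2 (.inr (up_not.1 hB')))
        · exact hU A hA B B' hB hB'
      refine .inl (isFullChainSystem_of_steps hF hs fun A B => ?_)
      exact (ht B A).imp (fun h x hx => by_contra fun hx' => h x hx' hx)
        fun h x hx => by_contra fun hx' => h x hx' hx

theorem additionality_eq_one (h : F.card = (ess F).card + 1) : additionality F = 1 := by
  unfold additionality
  omega

omit [Fintype X] in
theorem isFullChainSystem_of_isEmpty [IsEmpty X] (hF : F.Nonempty) : IsFullChainSystem F :=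
  (isFullChainSystem_iff hF).2 ⟨fun _ _ _ _ => .inl fun x => isEmptyElim x,
    isWellGraded_iff.2 fun A _ B _ h => absurd (Subsingleton.elim A B) h⟩

end Main

end SetSystem

theorem mainTheorem1 {X : Type*} [Fintype X] [DecidableEq X] (F : Finset (Finset X))
    (hF : F.Nonempty) :
    ((SetSystem.IsSelfAndDualWellGraded F ↔
        SetSystem.IsFullChainSystem F ∨ SetSystem.IsUpwardStarlike F ∨
          SetSystem.IsDownwardStarlike F) ∧
      (SetSystem.IsSelfAndDualWellGraded F → SetSystem.additionality F = 1)) ∧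
    ((SetSystem.IsSelfAndEssDualWellGraded F ↔ SetSystem.IsFullChainSystem F) ∧
      (SetSystem.IsSelfAndEssDualWellGraded F → SetSystem.additionality F = 1)) := by
  refine ⟨⟨⟨fun h => ?_, ?_⟩, fun h => ?_⟩, ⟨fun h => h.isFullChainSystem hF,
    fun h => h.isSelfAndEssDualWellGraded hF⟩,
    fun h => SetSystem.additionality_eq_one (h.card_eq_and_bounds hF).1⟩
  -- For empty `X` the dual is the empty family and the strict count does not apply to it.
  · rcases isEmpty_or_nonempty X
    · exact .inl (SetSystem.isFullChainSystem_of_isEmpty hF)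
    · exact h.classification hF
  · rintro (h | h | h)
    · exact h.isSelfAndDualWellGraded hF
    · exact h.isSelfAndDualWellGraded
    · exact h.isSelfAndDualWellGraded
  · rcases isEmpty_or_nonempty X
    · exact SetSystem.additionality_eq_one
        (((SetSystem.isFullChainSystem_of_isEmpty hF).isSelfAndEssDualWellGraded
          hF).card_eq_and_bounds hF).1
    · exact SetSystem.additionality_eq_one (h.card_eq hF).1
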